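/- Let $k$ be a natural number, let $\mathbf m$ be Lebesgue measure on $\mathbb R^k$, and let $(\mathcal X,\mathbf d)$ be a compact metric space with a continuous action $T\colon\mathbb R^k\times\mathcal X\to\mathcal X$. All logarithms are to base $2$. \textbf{Definitions.} For $L>0$ put $\bar{\mathbf d}_L(x,y)=\frac1{L^k}\int_{[0,L]^k}\mathbf d(T^ux,T^uy)\,d\mathbf m(u)$, and let $\operatorname{diam}(A,\bar{\mathbf d}_L)$ be the diameter of $A\subset\mathcal X$ in this metric. For random variables $X,Y$ with values in finite sets, $I(X;Y)=H(X)+H(Y)-H(X,Y)$, where $H$ is Shannon entropy. For general random variables, the mutual information $I(X;Y)$ is the supremum of $I(f(X);g(Y))$ over all measurable maps $f,g$ to finite sets. For a Borel set $A\subset\mathbb R^k$ of finite measure, $L^1(A,\mathcal X)$ is the space of measurable maps $A\to\mathcal X$ modulo equality $\mathbf m$-almost everywhere, with the metric $D(f,g)=\int_A\mathbf d(f(u),g(u))\,d\mathbf m(u)$ and its Borel $\sigma$-algebra. Let $\mu$ be a $T$-invariant Borel probability measure on $\mathcal X$. For $\varepsilon>0$ and bounded $A$ with $\mathbf m(A)>0$,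 let $R(\varepsilon,A)$ be the infimum of $I(X;Y)$ over all pairs of random variables $X,Y$ on a common probability space such that $X$ takes values in $\mathcal X$ and has law $\mu$, $Y$ takes values in $L^1(A,\mathcal X)$, and $$\mathbb E\Big(\frac1{\mathbf m(A)}\int_A\mathbf d(T^uX,Y_u)\,d\mathbf m(u)\Big)<\varepsilon .$$ Put $$R(\mathbf d,\mu,\varepsilon)=\lim_{L\to\infty}\frac{R(\varepsilon,[0,L)^k)}{L^k},\qquad \underline{\mathrm{rdim}}(\mathcal X,T,\mathbf d,\mu)=\liminf_{\varepsilon\to0}\frac{R(\mathbf d,\mu,\varepsilon)}{\log(1/\varepsilon)}$$ (the limit over $L$ is known to exist; it may be read as a lower limit). \textbf{Statement.} Let $s>0$, let $L_n>0$ $(n\ge1)$ satisfy $L_n\to\infty$, and let $\nu_n$ $(n\ge1)$ be (not necessarily invariant) Borel probability measures on $\mathcal X$. Define $$\mu_n=\frac1{L_n^k}\int_{[0,L_n]^k}T^u_*\nu_n\,d\mathbf m(u).$$ Assume: (1) there are $\delta>0$ and $C>0$ such that for every $n\ge 1$ and every Borel set $A\subset\mathcal X$ with $\operatorname{diam}(A,\bar{\mathbf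 d}_{L_n})<\delta$ we have $$\nu_n(A)\le\big(C\cdot\operatorname{diam}(A,\bar{\mathbf d}_{L_n})\big)^{sL_n^k};$$ (2) $\mu_n$ converges in the weak$^*$ topology to a $T$-invariant Borel probability measure $\mu$ on $\mathcal X$. Then $\underline{\mathrm{rdim}}(\mathcal X,T,\mathbf d,\mu)\ge s$. -/

import Mathlib

open MeasureTheory Filter Topology
open scoped ENNReal

universe u

noncomputable section

namespace RateDist

/-! ### Mutual information -/

section MutualInformation

variable {Ω : Type*} [MeasurableSpace Ω]

/-- Shannon entropy (to base `2`) of a random variable `ξ` with values in a finite set.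
The convention `0 log 0 = 0` holds since `Real.logb 2 0 = 0`. -/
def shannonEntropy {α : Type*} [Fintype α] (P : Measure Ω) (ξ : Ω → α) : ℝ :=
  -∑ a, P.real (ξ ⁻¹' {a}) * Real.logb 2 (P.real (ξ ⁻¹' {a}))

/-- Mutual information of two random variables with values in finite sets:
`I(ξ; η) = H(ξ) + H(η) - H(ξ, η)`. -/
def finMutualInfo {α β : Type*} [Fintype α] [Fintype β] (P : Measure Ω) (ξ : Ω → α) (η : Ω → β) :
    ℝ :=
  shannonEntropy P ξ + shannonEntropy P η - shannonEntropy P (fun ω => (ξ ω, η ω))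

/-- Mutual information `I(ξ; η)` in general: the supremum of `I(f(ξ); g(η))` over all measurable
maps `f`, `g` to finite (discrete) sets. -/
def mutualInfo {α β : Type*} [MeasurableSpace α] [MeasurableSpace β] (P : Measure Ω)
    (ξ : Ω → α) (η : Ω → β) : EReal :=
  ⨆ (m : ℕ) (n : ℕ) (f : α → Fin m) (g : β → Fin n) (_ : Measurable f) (_ : Measurable g),
    ((finMutualInfo P (f ∘ ξ) (g ∘ η) : ℝ) : EReal)

end MutualInformation

/-! ### The space of measurable maps modulo almost everywhere equality -/

/-- The space `L¹(A, X)` of measurable maps from `A ⊆ ℝᵏ` to `X`, modulo equality almost everywhere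
with respect to Lebesgue measure on `A`. -/
def L1Map {k : ℕ} (A : Set (Fin k → ℝ)) (X : Type*) [TopologicalSpace X] : Type _ :=
  (Fin k → ℝ) →ₘ[volume.restrict A] X

namespace L1Map

variable {k : ℕ} {A : Set (Fin k → ℝ)} {X : Type*}

/-- A representative of a class of maps. -/
instance [TopologicalSpace X] : CoeFun (L1Map A X) (fun _ => (Fin k → ℝ) → X) :=
  ⟨fun f => AEEqFun.cast f⟩

theorem aestronglyMeasurable [TopologicalSpace X] (f : L1Map A X) :
    AEStronglyMeasurable (f : (Fin k → ℝ) → X) (volume.restrict A) :=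
  AEEqFun.aestronglyMeasurable f

/-- The `L¹`-distance `D(f, g) = ∫_A d(f(u), g(u)) du` (finite if `X` is bounded and `A` has finite
measure). -/
instance [MetricSpace X] : EDist (L1Map A X) :=
  ⟨fun f g => ∫⁻ u in A, edist (f u) (g u)⟩

theorem edist_def [MetricSpace X] (f g : L1Map A X) :
    edist f g = ∫⁻ u in A, edist (f u) (g u) := rfl

instance [MetricSpace X] : EMetricSpace (L1Map A X) where
  edist_self f := by simp [edist_def]
  edist_comm f g := by simp only [edist_def, edist_comm]
  edist_triangle f g h := by
    simp only [edist_def]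
    rw [← lintegral_add_left' (f.aestronglyMeasurable.edist g.aestronglyMeasurable)]
    exact lintegral_mono fun u => edist_triangle _ _ _
  eq_of_edist_eq_zero {f g} hfg := by
    rw [edist_def, lintegral_eq_zero_iff'
      (f.aestronglyMeasurable.edist g.aestronglyMeasurable)] at hfg
    refine AEEqFun.ext (f := f) (g := g) ?_
    filter_upwards [hfg] with u hu
    exact edist_eq_zero.mp hu

instance [MetricSpace X] : MeasurableSpace (L1Map A X) := borel _

instance [MetricSpace X] : BorelSpace (L1Map A X) := ⟨rfl⟩

end L1Map

/-! ### Rate distortion theory of `ℝᵏ`-actions -/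

/-- The half-open cube `[0, L)ᵏ`. -/
def cubeIco (k : ℕ) (L : ℝ) : Set (Fin k → ℝ) := Set.univ.pi fun _ => Set.Ico 0 L

/-- The closed cube `[0, L]ᵏ`. -/
def cubeIcc (k : ℕ) (L : ℝ) : Set (Fin k → ℝ) := Set.univ.pi fun _ => Set.Icc 0 L

section Rate

variable {k : ℕ} {X : Type u} [MetricSpace X] [MeasurableSpace X] [AddAction (Fin k → ℝ) X]

/-- The expected distortion
`𝔼 ( 1/m(A) ∫_A d(Tᵘ ξ, η_u) du )` of a random point `ξ` of `X` and a random element `η` of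
`L¹(A, X)`. -/
def distortion {Ω : Type*} [MeasurableSpace Ω] (P : Measure Ω) (A : Set (Fin k → ℝ))
    (ξ : Ω → X) (η : Ω → L1Map A X) : ℝ≥0∞ :=
  ∫⁻ ω, ((volume A)⁻¹ * ∫⁻ u in A, edist (u +ᵥ ξ ω) (η ω u)) ∂P

/-- `R(ε, A)`: the infimum of `I(ξ; η)` over all pairs of random variables, defined on a common
probability space, such that `ξ` has law `μ`, `η` takes values in `L¹(A, X)`, and the expected
distortion is smaller than `ε`. -/
def rateOn (μ : Measure X) (ε : ℝ) (A : Set (Fin k → ℝ)) : EReal :=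
  sInf {r : EReal | ∃ (Ω : Type u) (_ : MeasurableSpace Ω) (P : Measure Ω) (ξ : Ω → X)
    (η : Ω → L1Map A X), IsProbabilityMeasure P ∧ Measurable ξ ∧ Measurable η ∧
      P.map ξ = μ ∧ distortion P A ξ η < ENNReal.ofReal ε ∧ r = mutualInfo P ξ η}

variable (k) in
/-- The rate distortion function `R(d, μ, ε) = lim_{L → ∞} R(ε, [0,L)ᵏ) / Lᵏ`. The limit is
written as a lower limit, which is the limit whenever the limit exists. -/
def rateDistortion (μ : Measure X) (ε : ℝ) : EReal :=
  liminf (fun L : ℝ => rateOn μ ε (cubeIco k L) / ((L ^ k : ℝ) : EReal)) atTop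

variable (k) in
/-- The lower rate distortion dimension `liminf_{ε → 0} R(d, μ, ε) / log (1/ε)`
(logarithm to base `2`). -/
def lowerRateDistortionDim (μ : Measure X) : EReal :=
  liminf (fun ε : ℝ => rateDistortion k μ ε / ((Real.logb 2 (1 / ε) : ℝ) : EReal)) (𝓝[>] 0)

end Rate

/-! ### Averaged metrics and averaged measures -/

section Average

variable {k : ℕ} {X : Type*} [MetricSpace X] [AddAction (Fin k → ℝ) X]

variable (k) in
/-- The averaged metric `d̄_L(x, y) = L⁻ᵏ ∫_{[0,L]ᵏ} d(Tᵘ x, Tᵘ y) du`. -/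
def avgDist (L : ℝ) (x y : X) : ℝ :=
  (L ^ k)⁻¹ * ∫ u in cubeIcc k L, dist (u +ᵥ x) (u +ᵥ y)

variable (k) in
/-- The diameter of `E` with respect to the averaged metric `d̄_L`. -/
def avgDiam (L : ℝ) (E : Set X) : ℝ≥0∞ :=
  ⨆ (x ∈ E) (y ∈ E), ENNReal.ofReal (avgDist k L x y)

theorem volume_cubeIcc {L : ℝ} (hL : 0 < L) : volume (cubeIcc k L) = ENNReal.ofReal (L ^ k) := by
  rw [cubeIcc, volume_pi_pi]
  simp [Real.volume_Icc, ENNReal.ofReal_pow hL.le]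

variable [MeasurableSpace X] [BorelSpace X] [ContinuousVAdd (Fin k → ℝ) X]

variable (k) in
/-- The orbit average `L⁻ᵏ ∫_{[0,L]ᵏ} Tᵘ_* ν du`, as a measure; see `orbitAverageMeasure_apply`. -/
def orbitAverageMeasure (L : ℝ) (ν : Measure X) : Measure X :=
  ENNReal.ofReal (L ^ k)⁻¹ •
    ((volume.restrict (cubeIcc k L)).prod ν).map fun p : (Fin k → ℝ) × X => p.1 +ᵥ p.2

theorem orbitAverageMeasure_apply (L : ℝ) (ν : Measure X) [SFinite ν] {E : Set X}
    (hE : MeasurableSet E) :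
    orbitAverageMeasure k L ν E =
      ENNReal.ofReal (L ^ k)⁻¹ *
        ∫⁻ u in cubeIcc k L, ν.map (fun x : X => u +ᵥ x) E := by
  have hm : Measurable fun p : (Fin k → ℝ) × X => p.1 +ᵥ p.2 := continuous_vadd.measurable
  rw [orbitAverageMeasure, Measure.smul_apply, smul_eq_mul, Measure.map_apply hm hE,
    Measure.prod_apply (hm hE)]
  congr 1
  refine lintegral_congr fun u => ?_
  rw [Measure.map_apply (continuous_const_vadd u).measurable hE]
  rfl

theorem isProbabilityMeasure_orbitAverageMeasure {L : ℝ} (hL : 0 < L) (ν : Measure X)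
    [IsProbabilityMeasure ν] : IsProbabilityMeasure (orbitAverageMeasure k L ν) := by
  constructor
  rw [orbitAverageMeasure_apply L ν MeasurableSet.univ]
  have h : ∀ u : Fin k → ℝ, ν.map (fun x : X => u +ᵥ x) Set.univ = 1 := fun u => by
    rw [Measure.map_apply (continuous_const_vadd u).measurable MeasurableSet.univ]
    simp
  simp only [h, lintegral_const, one_mul, Measure.restrict_apply MeasurableSet.univ,
    Set.univ_inter, volume_cubeIcc hL]
  rw [← ENNReal.ofReal_mul (by positivity), inv_mul_cancel₀ (by positivity), ENNReal.ofReal_one]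

variable (k) in
/-- The orbit average `L⁻ᵏ ∫_{[0,L]ᵏ} Tᵘ_* ν du` of a probability measure `ν`, for `L > 0`. -/
def orbitAverage {L : ℝ} (hL : 0 < L) (ν : ProbabilityMeasure X) : ProbabilityMeasure X :=
  ⟨orbitAverageMeasure k L (ν : Measure X),
    isProbabilityMeasure_orbitAverageMeasure hL (ν : Measure X)⟩

end Average

end RateDist

end

/-! The argument is a duality. By the Gibbs variational inequality, `log 2` times the mutual
information plus `a` times an expected cost is at least the mean of a free energy `-log ∑ⱼ qⱼ exp(-a
ρⱼ(x))`. After quantization, any admissible pair for the cube `[0,L)ᵏ` yields such a lower bound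
with finitely many costs `ρⱼ(x) = ∫ d(Tᵘx, yⱼ(u)) du` (`exists_integral_freeEnergy_le`). This free
energy is continuous in `x`, so its integral against `μ` is the limit of its integrals against
`μ_n`; no convergence of couplings or of mutual information is needed.

For `μ_n` (`le_integral_freeEnergy_orbitAverageMeasure`), tile a cube of side `R = L_n` by
translates of `[0,L)ᵏ` and sum the free energy over the tiles. The product of the partition sums
expands into an average over tuples of maps, so Jensen's inequality reduces the matter to bounding
`∫ exp(-aΨ) dν_n` for the total cost `Ψ` of each tuple (`integral_exp_neg_le`). Two points at which
`Ψ` is at most `Rᵏ r` are close in the averaged metric, by the triangle inequality. The power law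
thus bounds the measure of that set by `(3Cr)^(s Rᵏ)`, and off it the integrand is at most `exp(-a
Rᵏ r)`.

With `a = 1/ε` and `r = s ε log(1/ε)`, both exponents are about `s log(1/ε)` per unit volume, up to
lower-order terms. This is the claimed dimension. -/

namespace RateDist

/-! ### The Gibbs variational inequality for finite mutual information -/

section Gibbs

/-- Nonnegativity of relative entropy, from `log t ≤ t - 1` at `t = w i / r i`. Only a comparison of
total masses is needed. Absolute continuity `h0` is required because `Real.log 0 = 0`. -/
theorem sum_mul_log_sub_log_nonneg {ι : Type*} [Fintype ι] (r w : ι → ℝ) (hr : ∀ i, 0 ≤ r i)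
    (hw : ∀ i, 0 ≤ w i) (h0 : ∀ i, w i = 0 → r i = 0) (hsum : ∑ i, w i ≤ ∑ i, r i) :
    0 ≤ ∑ i, r i * (Real.log (r i) - Real.log (w i)) := by
  have key : ∀ i, r i - w i ≤ r i * (Real.log (r i) - Real.log (w i)) := by
    intro i
    rcases (hr i).eq_or_lt with h | h
    · rw [← h]; simpa using hw i
    · have hwi : 0 < w i := (hw i).lt_of_ne fun h' => h.ne' (h0 i h'.symm)
      have h1 := Real.log_le_sub_one_of_pos (div_pos hwi h)
      rw [Real.log_div hwi.ne' h.ne'] at h1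
      have h2 := mul_le_mul_of_nonneg_left h1 h.le
      have h3 : r i * (w i / r i - 1) = w i - r i := by field_simp
      linarith
  calc (0 : ℝ) ≤ ∑ i, (r i - w i) := by rw [Finset.sum_sub_distrib]; linarith
    _ ≤ _ := Finset.sum_le_sum fun i _ => key i

theorem log_two_mul_shannonEntropy {Ω α : Type*} [MeasurableSpace Ω] [Fintype α] (P : Measure Ω)
    (ξ : Ω → α) : Real.log 2 * shannonEntropy P ξ =
      -∑ a, P.real (ξ ⁻¹' {a}) * Real.log (P.real (ξ ⁻¹' {a})) := by
  have h2 : Real.log 2 ≠ 0 := (Real.log_pos one_lt_two).ne'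
  rw [shannonEntropy, mul_neg, Finset.mul_sum]
  congr 1
  refine Finset.sum_congr rfl fun c _ => ?_
  rw [Real.logb]
  field_simp

theorem finMutualInfo_le_mutualInfo {Ω S Y : Type*} [MeasurableSpace Ω] [MeasurableSpace S]
    [MeasurableSpace Y] (P : Measure Ω) (ξ : Ω → S) (η : Ω → Y) {m n : ℕ} {f : S → Fin m}
    {g : Y → Fin n} (hf : Measurable f) (hg : Measurable g) :
    ((finMutualInfo P (f ∘ ξ) (g ∘ η) : ℝ) : EReal) ≤ mutualInfo P ξ η :=
  le_iSup_of_le m <| le_iSup_of_le n <| le_iSup_of_le f <| le_iSup_of_le g <|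
    le_iSup_of_le hf <| le_iSup_of_le hg le_rfl

theorem sum_measureReal_pair_right {Ω α β : Type*} [MeasurableSpace Ω] [Fintype β]
    [MeasurableSpace β] [MeasurableSingletonClass β] (P : Measure Ω) [IsFiniteMeasure P]
    (ξ : Ω → α) {η : Ω → β} (hη : Measurable η) (a : α) :
    ∑ b, P.real ((fun ω => (ξ ω, η ω)) ⁻¹' {(a, b)}) = P.real (ξ ⁻¹' {a}) := by
  -- Restrict `P` to a fibre of `ξ`; the fibres of `η` then partition it.
  have h := sum_measureReal_preimage_singleton (μ := P.restrict (ξ ⁻¹' {a})) (f := η)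
    Finset.univ fun y _ => hη (measurableSet_singleton y)
  simp only [Finset.coe_univ, Set.preimage_univ, measureReal_restrict_apply_univ] at h
  rw [← h]
  refine Finset.sum_congr rfl fun b _ => ?_
  rw [measureReal_restrict_apply (hη (measurableSet_singleton b))]
  congr 1
  ext ω
  simp [and_comm]

theorem sum_measureReal_pair_left {Ω α β : Type*} [MeasurableSpace Ω] [Fintype α]
    [MeasurableSpace α] [MeasurableSingletonClass α] (P : Measure Ω) [IsFiniteMeasure P]
    {ξ : Ω → α} (hξ : Measurable ξ) (η : Ω → β) (b : β) :
    ∑ a, P.real ((fun ω => (ξ ω, η ω)) ⁻¹' {(a, b)}) = P.real (η ⁻¹' {b}) := by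
  rw [← sum_measureReal_pair_right P η hξ b]
  refine Finset.sum_congr rfl fun a _ => ?_
  congr 1
  ext ω
  simp [and_comm]

variable {Ω α β : Type*} [MeasurableSpace Ω] [Fintype α] [Fintype β]
  [MeasurableSpace α] [MeasurableSpace β] [MeasurableSingletonClass α] [MeasurableSingletonClass β]
  (P : Measure Ω) [IsProbabilityMeasure P] {ξ : Ω → α} {η : Ω → β}

theorem sum_measureReal_fiber (hξ : Measurable ξ) : ∑ a, P.real (ξ ⁻¹' {a}) = 1 := by
  have h := sum_measureReal_preimage_singleton (μ := P) (f := ξ)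
    Finset.univ fun y _ => hξ (measurableSet_singleton y)
  simpa using h

theorem integral_comp_eq_sum (hξ : Measurable ξ) (F : α → ℝ) :
    ∫ ω, F (ξ ω) ∂P = ∑ a, P.real (ξ ⁻¹' {a}) * F a := by
  have : IsProbabilityMeasure (P.map ξ) := Measure.isProbabilityMeasure_map hξ.aemeasurable
  rw [← integral_map hξ.aemeasurable (f := F)
    (measurable_of_finite F).aestronglyMeasurable, integral_fintype (.of_finite)]
  refine Finset.sum_congr rfl fun a _ => ?_
  rw [map_measureReal_apply hξ (measurableSet_singleton a), smul_eq_mul]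

theorem log_two_mul_finMutualInfo (hξ : Measurable ξ) (hη : Measurable η) :
    Real.log 2 * finMutualInfo P ξ η =
      ∑ a, ∑ b, P.real ((fun ω => (ξ ω, η ω)) ⁻¹' {(a, b)}) *
        (Real.log (P.real ((fun ω => (ξ ω, η ω)) ⁻¹' {(a, b)})) -
          Real.log (P.real (ξ ⁻¹' {a})) - Real.log (P.real (η ⁻¹' {b}))) := by
  have h2 : Real.log 2 ≠ 0 := (Real.log_pos one_lt_two).ne'
  have hα : Real.log 2 * shannonEntropy P ξ =
      -∑ a, ∑ b, P.real ((fun ω => (ξ ω, η ω)) ⁻¹' {(a, b)}) *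
        Real.log (P.real (ξ ⁻¹' {a})) := by
    rw [shannonEntropy, mul_neg, Finset.mul_sum]
    congr 1
    refine Finset.sum_congr rfl fun a _ => ?_
    rw [← Finset.sum_mul, sum_measureReal_pair_right P ξ hη, Real.logb]
    field_simp
  have hβ : Real.log 2 * shannonEntropy P η =
      -∑ a, ∑ b, P.real ((fun ω => (ξ ω, η ω)) ⁻¹' {(a, b)}) *
        Real.log (P.real (η ⁻¹' {b})) := by
    rw [Finset.sum_comm, shannonEntropy, mul_neg, Finset.mul_sum]
    congr 1
    refine Finset.sum_congr rfl fun b _ => ?_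
    rw [← Finset.sum_mul, sum_measureReal_pair_left P hξ η, Real.logb]
    field_simp
  rw [finMutualInfo, mul_sub, mul_add, hα, hβ, log_two_mul_shannonEntropy, Fintype.sum_prod_type]
  simp only [mul_sub, Finset.sum_sub_distrib]
  ring

/-- The Gibbs variational inequality: mutual information plus expected cost is bounded from below
by the free energy. -/
theorem neg_sum_mul_log_sum_exp_le (hξ : Measurable ξ) (hη : Measurable η) (d : α → β → ℝ) :
    -∑ a, P.real (ξ ⁻¹' {a}) * Real.log (∑ b, P.real (η ⁻¹' {b}) * Real.exp (-d a b)) ≤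
      Real.log 2 * finMutualInfo P ξ η + ∫ ω, d (ξ ω) (η ω) ∂P := by
  have hint : ∫ ω, d (ξ ω) (η ω) ∂P =
      ∑ a, ∑ b, P.real ((fun ω => (ξ ω, η ω)) ⁻¹' {(a, b)}) * d a b := by
    rw [← Fintype.sum_prod_type', ← integral_comp_eq_sum P (hξ.prodMk hη) fun c => d c.1 c.2]
  have hright := sum_measureReal_pair_right P ξ hη
  have hleft := sum_measureReal_pair_left P hξ η
  have hη1 := sum_measureReal_fiber P hη
  have hξ1 := sum_measureReal_fiber P hξ
  rw [hint, log_two_mul_finMutualInfo P hξ hη]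
  set r : α → β → ℝ := fun a b => P.real ((fun ω => (ξ ω, η ω)) ⁻¹' {(a, b)}) with hr
  set p : α → ℝ := fun a => P.real (ξ ⁻¹' {a}) with hp
  set q : β → ℝ := fun b => P.real (η ⁻¹' {b}) with hq
  change ∀ a, ∑ b, r a b = p a at hright
  change ∀ b, ∑ a, r a b = q b at hleft
  change ∑ b, q b = 1 at hη1
  change ∑ a, p a = 1 at hξ1
  change -∑ a, p a * Real.log (∑ b, q b * Real.exp (-d a b)) ≤
    ∑ a, ∑ b, r a b * (Real.log (r a b) - Real.log (p a) - Real.log (q b)) +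
      ∑ a, ∑ b, r a b * d a b
  have r0 : ∀ a b, 0 ≤ r a b := fun a b => measureReal_nonneg
  have p0 : ∀ a, 0 ≤ p a := fun a => measureReal_nonneg
  have q0 : ∀ b, 0 ≤ q b := fun b => measureReal_nonneg
  have rp : ∀ a b, p a = 0 → r a b = 0 := fun a b h =>
    (Finset.sum_eq_zero_iff_of_nonneg fun b _ => r0 a b).1 ((hright a).trans h) b (Finset.mem_univ b)
  have rq : ∀ a b, q b = 0 → r a b = 0 := fun a b h =>
    (Finset.sum_eq_zero_iff_of_nonneg fun a _ => r0 a b).1 ((hleft b).trans h) a (Finset.mem_univ a)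
  set Z : α → ℝ := fun a => ∑ b, q b * Real.exp (-d a b) with hZ
  have Zpos : ∀ a, 0 < Z a := by
    intro a
    refine Finset.sum_pos' (fun b _ => mul_nonneg (q0 b) (Real.exp_pos _).le) ?_
    by_contra! hcon
    have : ∀ b, q b = 0 := fun b => by
      have := hcon b (Finset.mem_univ b)
      exact le_antisymm (nonpos_of_mul_nonpos_left this (Real.exp_pos _)) (q0 b)
    simp [this] at hη1
  -- Compare the joint law with the Gibbs law `p a * q b * exp(-d a b) / Z a`, which has the same
  -- first marginal `p`, hence the same total mass.
  have key := sum_mul_log_sub_log_nonneg (fun c : α × β => r c.1 c.2)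
    (fun c => p c.1 * (q c.2 * Real.exp (-d c.1 c.2)) / Z c.1) (fun c => r0 _ _)
    (fun c => div_nonneg (mul_nonneg (p0 _) (mul_nonneg (q0 _) (Real.exp_pos _).le)) (Zpos _).le)
    (fun c h => by
      rcases div_eq_zero_iff.1 h with h | h
      · rcases mul_eq_zero.1 h with h | h
        · exact rp _ _ h
        · exact rq _ _ ((mul_eq_zero.1 h).resolve_right (Real.exp_pos _).ne')
      · exact absurd h (Zpos _).ne')
    (by
      rw [Fintype.sum_prod_type, Fintype.sum_prod_type]
      refine le_of_eq (Finset.sum_congr rfl fun a _ => ?_)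
      simp only
      rw [hright, ← Finset.sum_div, ← Finset.mul_sum]
      exact mul_div_cancel_right₀ _ (Zpos a).ne')
  have hterm : ∀ a b, r a b * (Real.log (r a b) -
      Real.log (p a * (q b * Real.exp (-d a b)) / Z a)) =
      r a b * (Real.log (r a b) - Real.log (p a) - Real.log (q b)) + r a b * d a b
        + r a b * Real.log (Z a) := by
    intro a b
    by_cases h : r a b = 0
    · simp [h]
    have hpa : p a ≠ 0 := fun h' => h (rp a b h')
    have hqb : q b ≠ 0 := fun h' => h (rq a b h')
    have he := (Real.exp_pos (-d a b)).ne'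
    rw [Real.log_div (by positivity) (Zpos a).ne', Real.log_mul hpa (by positivity),
      Real.log_mul hqb he, Real.log_exp]
    ring
  rw [Fintype.sum_prod_type] at key
  simp only [hterm, Finset.sum_add_distrib] at key
  simp only [← Finset.sum_mul, hright] at key
  linarith

/-- Finitely many bounded measurable functions can be simultaneously approximated from below
through a measurable map to a finite set. -/
theorem exists_measurable_quantization {Y ι : Type*} [MeasurableSpace Y] [Fintype ι]
    (F : ι → Y → ℝ) (hF : ∀ i, Measurable (F i)) (h0 : ∀ i y, 0 ≤ F i y) {B : ℝ}
    (hB : ∀ i y, F i y ≤ B) {θ : ℝ} (hθ : 0 < θ) :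
    ∃ (n : ℕ) (g : Y → Fin n) (d : ι → Fin n → ℝ), Measurable g ∧ (∀ i j, 0 ≤ d i j) ∧
      ∀ i y, d i (g y) ≤ F i y ∧ F i y ≤ d i (g y) + θ := by
  classical
  let K := ⌊B / θ⌋₊ + 1
  have hK : ∀ i y, ⌊F i y / θ⌋₊ < K := fun i y =>
    Nat.lt_succ_of_le (Nat.floor_le_floor (div_le_div_of_nonneg_right (hB i y) hθ.le))
  -- All values are rounded down to multiples of `θ`; the vector of multiples takes finitely many
  -- values and serves as the code of `y`.
  let G : Y → ι → Fin K := fun y i => ⟨⌊F i y / θ⌋₊, hK i y⟩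
  have hG : Measurable G := by
    refine measurable_pi_lambda _ fun i => ?_
    refine measurable_to_countable' fun j => ?_
    have : (fun y => G y i) ⁻¹' {j} = (fun y => ⌊F i y / θ⌋₊) ⁻¹' {(j : ℕ)} := by
      ext y; simp [G, Fin.ext_iff]
    rw [this]
    exact (Nat.measurable_floor.comp ((hF i).div_const θ)) (measurableSet_singleton _)
  let e := Fintype.equivFin (ι → Fin K)
  refine ⟨_, fun y => e (G y), fun i j => θ * ((e.symm j i : Fin K) : ℕ),
    (measurable_of_finite e).comp hG, fun i j => by positivity, fun i y => ?_⟩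
  have h1 := Nat.floor_le (div_nonneg (h0 i y) hθ.le)
  have h2 := (Nat.lt_floor_add_one (F i y / θ)).le
  rw [le_div_iff₀ hθ] at h1
  rw [div_le_iff₀ hθ] at h2
  simp only [Equiv.symm_apply_apply, G]
  constructor <;> linarith

end Gibbs

/-! ### Free energies -/

section FreeEnergy

/-- The free energy `-log ∑ⱼ qⱼ exp(-a ρⱼ(x))` of finitely many cost functions `ρⱼ`. -/
noncomputable def freeEnergy {S ι : Type*} [Fintype ι] (a : ℝ) (q : ι → ℝ) (ρ : ι → S → ℝ)
    (x : S) : ℝ :=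
  -Real.log (∑ j, q j * Real.exp (-(a * ρ j x)))

variable {S ι : Type*} [Fintype ι] {a : ℝ} {q : ι → ℝ} {ρ : ι → S → ℝ}

theorem sum_mul_exp_pos (hq : ∀ j, 0 ≤ q j) (hq1 : ∑ j, q j = 1) (t : ι → ℝ) :
    0 < ∑ j, q j * Real.exp (t j) := by
  refine Finset.sum_pos' (fun b _ => mul_nonneg (hq b) (Real.exp_pos _).le) ?_
  by_contra! hcon
  have : ∀ b, q b = 0 := fun b =>
    le_antisymm (nonpos_of_mul_nonpos_left (hcon b (Finset.mem_univ b)) (Real.exp_pos _)) (hq b)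
  simp [this] at hq1

theorem freeEnergy_nonneg (ha : 0 ≤ a) (hq : ∀ j, 0 ≤ q j) (hq1 : ∑ j, q j = 1)
    (hρ : ∀ j x, 0 ≤ ρ j x) (x : S) : 0 ≤ freeEnergy a q ρ x := by
  rw [freeEnergy, Left.nonneg_neg_iff]
  refine Real.log_nonpos (sum_mul_exp_pos hq hq1 _).le ?_
  rw [← hq1]
  refine Finset.sum_le_sum fun j _ => mul_le_of_le_one_right (hq j) ?_
  rw [Real.exp_le_one_iff]
  have := mul_nonneg ha (hρ j x)
  linarith

theorem continuous_freeEnergy [TopologicalSpace S] (hq : ∀ j, 0 ≤ q j) (hq1 : ∑ j, q j = 1)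
    (hρ : ∀ j, Continuous (ρ j)) : Continuous (freeEnergy a q ρ) := by
  unfold freeEnergy
  refine (Continuous.log ?_ fun x => (sum_mul_exp_pos hq hq1 _).ne').neg
  fun_prop

/-- Jensen's inequality for a sum of free energies along finitely many maps. -/
theorem neg_log_le_integral_sum_freeEnergy {S' I : Type*} [Fintype I] [DecidableEq I]
    [TopologicalSpace S] [TopologicalSpace S'] [CompactSpace S] [MeasurableSpace S]
    [OpensMeasurableSpace S] (ν : Measure S) [IsProbabilityMeasure ν] {ρ : ι → S' → ℝ}
    (hq : ∀ j, 0 ≤ q j) (hq1 : ∑ j, q j = 1) (hρ : ∀ j, Continuous (ρ j)) (T : I → S → S')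
    (hT : ∀ i, Continuous (T i)) {M : ℝ} (hM : 0 < M)
    (hle : ∀ c : I → ι, ∫ x, Real.exp (-(a * ∑ i, ρ (c i) (T i x))) ∂ν ≤ M) :
    -Real.log M ≤ ∫ x, ∑ i, freeEnergy a q ρ (T i x) ∂ν := by
  have hint : ∀ {F : S → ℝ}, Continuous F → Integrable F ν := fun hF =>
    hF.integrable_of_hasCompactSupport (HasCompactSupport.of_compactSpace _)
  -- Expanding this product of sums gives a mixture over tuples `c`, with product weights of total
  -- mass one, so its integral is at most `M`.
  let Z : S → ℝ := fun x => ∏ i, ∑ j, q j * Real.exp (-(a * ρ j (T i x)))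
  have hZ : ∀ x, Z x = ∑ c : I → ι, (∏ i, q (c i)) *
      Real.exp (-(a * ∑ i, ρ (c i) (T i x))) := by
    intro x
    simp only [Z]
    rw [Finset.prod_univ_sum, Fintype.piFinset_univ]
    refine Finset.sum_congr rfl fun c _ => ?_
    rw [Finset.prod_mul_distrib, ← Real.exp_sum, Finset.mul_sum, Finset.sum_neg_distrib]
  have hZpos : ∀ x, 0 < Z x := fun x => Finset.prod_pos fun i _ => sum_mul_exp_pos hq hq1 _
  have hsum1 : ∑ c : I → ι, ∏ i, q (c i) = 1 := by
    rw [← Fintype.piFinset_univ, ← Finset.prod_univ_sum]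
    simp [hq1]
  have hZc : Continuous Z := by fun_prop
  have hZint : ∫ x, Z x ∂ν ≤ M := by
    simp only [hZ]
    rw [integral_finsetSum]
    · simp only [integral_const_mul]
      calc _ ≤ ∑ c : I → ι, (∏ i, q (c i)) * M :=
            Finset.sum_le_sum fun c _ => mul_le_mul_of_nonneg_left (hle c)
              (Finset.prod_nonneg fun i _ => hq _)
        _ = M := by rw [← Finset.sum_mul, hsum1, one_mul]
    · intro c _
      refine hint ?_
      fun_prop
  -- Jensen's inequality in tangent-line form: `log` lies below its tangent at `M`.
  have hpt : ∀ x, (1 - Real.log M) - Z x / M ≤ ∑ i, freeEnergy a q ρ (T i x) := by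
    intro x
    have h1 : ∑ i, freeEnergy a q ρ (T i x) = -Real.log (Z x) := by
      simp only [Z, freeEnergy]
      rw [Real.log_prod fun i _ => (sum_mul_exp_pos hq hq1 _).ne', Finset.sum_neg_distrib]
    have h2 := Real.log_le_sub_one_of_pos (div_pos (hZpos x) hM)
    rw [Real.log_div (hZpos x).ne' hM.ne'] at h2
    rw [h1]
    linarith
  have hZM : Integrable (fun x => Z x / M) ν := (hint hZc).div_const M
  have hmono := integral_mono (μ := ν) ((integrable_const (1 - Real.log M)).sub hZM)
    (hint (continuous_finsetSum _ fun i _ =>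
      (continuous_freeEnergy (a := a) hq hq1 hρ).comp (hT i))) hpt
  refine le_trans ?_ hmono
  have heq : ∫ x, ((1 - Real.log M) - Z x / M) ∂ν =
      (1 - Real.log M) - (∫ x, Z x ∂ν) / M := by
    rw [integral_sub (integrable_const _) hZM, integral_div]
    simp
  have : (∫ x, Z x ∂ν) / M ≤ 1 := (div_le_one hM).2 hZint
  refine le_trans ?_ heq.ge
  linarith

end FreeEnergy

/-! ### The cost of describing an orbit by a map -/

section OrbitCost

variable {k : ℕ} {X : Type u} [MetricSpace X] [AddAction (Fin k → ℝ) X]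

/-- The integrated distance `∫_A d(Tᵘ x, y_u) du`. -/
noncomputable def orbitCost (A : Set (Fin k → ℝ)) (y : (Fin k → ℝ) → X) (x : X) : ℝ :=
  ∫ u in A, dist (u +ᵥ x) (y u)

theorem orbitCost_nonneg (A : Set (Fin k → ℝ)) (y : (Fin k → ℝ) → X) (x : X) :
    0 ≤ orbitCost A y x :=
  integral_nonneg fun _ => dist_nonneg

theorem orbitCost_orbit_comm (A : Set (Fin k → ℝ)) (x x' : X) :
    orbitCost A (fun u => u +ᵥ x') x = orbitCost A (fun u => u +ᵥ x) x' := by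
  simp only [orbitCost, dist_comm]

theorem continuous_orbit [ContinuousVAdd (Fin k → ℝ) X] (x : X) : Continuous fun u : Fin k → ℝ => u +ᵥ x := by fun_prop

variable [CompactSpace X]

theorem dist_le_diam_univ (x y : X) : dist x y ≤ Metric.diam (Set.univ : Set X) :=
  Metric.dist_le_diam_of_mem isCompact_univ.isBounded (Set.mem_univ x) (Set.mem_univ y)

variable [ContinuousVAdd (Fin k → ℝ) X]

theorem aestronglyMeasurable_dist_orbit {A : Set (Fin k → ℝ)} {y : (Fin k → ℝ) → X}
    (hy : AEStronglyMeasurable y (volume.restrict A)) (x : X) :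
    AEStronglyMeasurable (fun u => dist (u +ᵥ x) (y u)) (volume.restrict A) :=
  (continuous_orbit x).aestronglyMeasurable.dist hy

theorem integrableOn_dist_orbit {A : Set (Fin k → ℝ)} (hA : volume A ≠ ∞)
    {y : (Fin k → ℝ) → X} (hy : AEStronglyMeasurable y (volume.restrict A)) (x : X) :
    IntegrableOn (fun u => dist (u +ᵥ x) (y u)) A := by
  have : IsFiniteMeasure (volume.restrict A) := isFiniteMeasure_restrict.2 hA
  refine Integrable.of_bound (aestronglyMeasurable_dist_orbit hy x)
    (Metric.diam (Set.univ : Set X)) (Eventually.of_forall fun u => ?_)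
  rw [Real.norm_of_nonneg dist_nonneg]
  exact dist_le_diam_univ _ _

theorem continuous_orbitCost {A : Set (Fin k → ℝ)} (hA : volume A ≠ ∞)
    {y : (Fin k → ℝ) → X} (hy : AEStronglyMeasurable y (volume.restrict A)) :
    Continuous (orbitCost A y) := by
  have : IsFiniteMeasure (volume.restrict A) := isFiniteMeasure_restrict.2 hA
  refine continuous_of_dominated (bound := fun _ => Metric.diam (Set.univ : Set X))
    (fun x => aestronglyMeasurable_dist_orbit hy x)
    (fun x => Eventually.of_forall fun u => ?_) (integrable_const _)
    (Eventually.of_forall fun u => ?_)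
  · rw [Real.norm_of_nonneg dist_nonneg]
    exact dist_le_diam_univ _ _
  · fun_prop

theorem orbitCost_le_add {A : Set (Fin k → ℝ)} (hA : volume A ≠ ∞)
    {y : (Fin k → ℝ) → X} (hy : AEStronglyMeasurable y (volume.restrict A)) (x x' : X) :
    orbitCost A y x ≤ orbitCost A (fun u => u +ᵥ x') x + orbitCost A y x' := by
  have h1 := integrableOn_dist_orbit hA (continuous_orbit x').aestronglyMeasurable x
  have h2 := integrableOn_dist_orbit hA hy x'
  rw [orbitCost, orbitCost, orbitCost, ← integral_add h1 h2]
  exact integral_mono (integrableOn_dist_orbit hA hy x) (h1.add h2) fun u => dist_triangle _ _ _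

theorem orbitCost_orbit_le_add {A : Set (Fin k → ℝ)} (hA : volume A ≠ ∞)
    {y : (Fin k → ℝ) → X} (hy : AEStronglyMeasurable y (volume.restrict A)) (x x' : X) :
    orbitCost A (fun u => u +ᵥ x') x ≤ orbitCost A y x + orbitCost A y x' := by
  have h1 := integrableOn_dist_orbit hA hy x
  have h2 := integrableOn_dist_orbit hA hy x'
  rw [orbitCost, orbitCost, orbitCost, ← integral_add h1 h2]
  exact integral_mono (integrableOn_dist_orbit hA (continuous_orbit x').aestronglyMeasurable x)
    (h1.add h2) fun u => dist_triangle_right _ _ _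

theorem ofReal_orbitCost {A : Set (Fin k → ℝ)} (hA : volume A ≠ ∞)
    {y : (Fin k → ℝ) → X} (hy : AEStronglyMeasurable y (volume.restrict A)) (x : X) :
    ENNReal.ofReal (orbitCost A y x) = ∫⁻ u in A, edist (u +ᵥ x) (y u) := by
  rw [orbitCost, ofReal_integral_eq_lintegral_ofReal (integrableOn_dist_orbit hA hy x)
    (Eventually.of_forall fun u => dist_nonneg)]
  simp only [edist_dist]

/-- The orbit of `x` is itself a point of `L1Map A X`, and the cost is the distance from `y` to it,
which is continuous in `y`. -/
theorem measurable_orbitCost_L1Map {A : Set (Fin k → ℝ)} (hA : volume A ≠ ∞) (x : X) :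
    Measurable fun y : L1Map A X => orbitCost A y x := by
  let e : L1Map A X := AEEqFun.mk (fun u => u +ᵥ x) (continuous_orbit x).aestronglyMeasurable
  have he : ∀ y : L1Map A X, orbitCost A y x = (edist e y).toReal := by
    intro y
    rw [← ENNReal.toReal_ofReal (orbitCost_nonneg A y x),
      ofReal_orbitCost hA y.aestronglyMeasurable, L1Map.edist_def]
    congr 1
    refine lintegral_congr_ae ?_
    filter_upwards [AEEqFun.coeFn_mk (fun u => u +ᵥ x)
      (continuous_orbit x).aestronglyMeasurable] with u hu
    rw [← hu]
  simp only [he]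
  exact (continuous_const.edist continuous_id).measurable.ennreal_toReal

end OrbitCost

/-! ### Lower bound of the mutual information by a free energy -/

section Quantization

/-- A family of neighbourhoods of the points of a compact space is refined by a finite measurable
partition. -/
theorem exists_measurable_index {S : Type*} [TopologicalSpace S] [CompactSpace S]
    [MeasurableSpace S] [OpensMeasurableSpace S] (U : S → Set S) (hU : ∀ x, IsOpen (U x))
    (hxU : ∀ x, x ∈ U x) :
    ∃ (m : ℕ) (c : Fin m → S) (f : S → Fin m), Measurable f ∧ ∀ x, x ∈ U (c (f x)) := by
  classical
  obtain ⟨t, ht⟩ := CompactSpace.elim_nhds_subcover U fun x => (hU x).mem_nhds (hxU x)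
  let c : Fin t.card → S := fun i => t.equivFin.symm i
  have hex : ∀ x, ∃ n, ∃ h : n < t.card, x ∈ U (c ⟨n, h⟩) := by
    intro x
    have hx : x ∈ ⋃ y ∈ t, U y := ht ▸ Set.mem_univ x
    simp only [Set.mem_iUnion] at hx
    obtain ⟨y, hy, hxy⟩ := hx
    exact ⟨t.equivFin ⟨y, hy⟩, (t.equivFin ⟨y, hy⟩).2, by simpa [c] using hxy⟩
  -- Each point is assigned the first member of the finite subcover that contains it.
  have hmeas : Measurable fun x => Nat.find (hex x) := by
    refine Measurable.find (f := fun n _ => n) (fun n => measurable_const) (fun n => ?_) hex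
    by_cases h : n < t.card
    · simpa [h] using (hU _).measurableSet
    · simp [h]
  refine ⟨t.card, c, fun x => ⟨Nat.find (hex x), (Nat.find_spec (hex x)).1⟩, ?_,
    fun x => (Nat.find_spec (hex x)).2⟩
  refine measurable_to_countable' fun j => ?_
  convert hmeas (measurableSet_singleton (j : ℕ)) using 1
  ext x
  simp [Fin.ext_iff]

variable {k : ℕ} {X : Type u} [MetricSpace X] [CompactSpace X]
  [AddAction (Fin k → ℝ) X] [ContinuousVAdd (Fin k → ℝ) X]

/-- The expected cost of a quantized description, in terms of the distortion. -/
theorem integral_le_of_distortion_lt {Ω : Type u} [MeasurableSpace Ω] (P : Measure Ω)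
    [IsProbabilityMeasure P] {A : Set (Fin k → ℝ)} (hA : volume A ≠ ∞) (hA0 : volume A ≠ 0)
    {ξ : Ω → X} {η : Ω → L1Map A X} {ε : ℝ} (hε : 0 < ε)
    (hdist : distortion P A ξ η < ENNReal.ofReal ε) {θ : ℝ} (hθ : 0 ≤ θ) {F : Ω → ℝ}
    (hF : Measurable F) (hF0 : ∀ ω, 0 ≤ F ω) (hle : ∀ ω, F ω ≤ orbitCost A (η ω) (ξ ω) + θ) :
    ∫ ω, F ω ∂P ≤ volume.real A * ε + θ := by
  rw [integral_eq_lintegral_of_nonneg_ae (Eventually.of_forall hF0) hF.aestronglyMeasurable]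
  have hV : 0 ≤ volume.real A * ε := by positivity
  refine ENNReal.toReal_le_of_le_ofReal (by linarith) ?_
  rw [distortion, lintegral_const_mul' _ _ (ENNReal.inv_ne_top.2 hA0)] at hdist
  have h1 : ∫⁻ ω, (∫⁻ u in A, edist (u +ᵥ ξ ω) (η ω u)) ∂P ≤ volume A * ENNReal.ofReal ε := by
    rw [mul_comm, ← ENNReal.div_le_iff hA0 hA, ENNReal.div_eq_inv_mul]
    exact hdist.le
  calc ∫⁻ ω, ENNReal.ofReal (F ω) ∂P
      ≤ ∫⁻ ω, ((∫⁻ u in A, edist (u +ᵥ ξ ω) (η ω u)) + ENNReal.ofReal θ) ∂P := by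
        refine lintegral_mono fun ω => ?_
        rw [← ofReal_orbitCost hA (η ω).aestronglyMeasurable,
          ← ENNReal.ofReal_add (orbitCost_nonneg _ _ _) hθ]
        exact ENNReal.ofReal_le_ofReal (hle ω)
    _ = (∫⁻ ω, (∫⁻ u in A, edist (u +ᵥ ξ ω) (η ω u)) ∂P) + ENNReal.ofReal θ := by
        rw [lintegral_add_right _ measurable_const]
        simp
    _ ≤ volume A * ENNReal.ofReal ε + ENNReal.ofReal θ := by gcongr
    _ = ENNReal.ofReal (volume.real A * ε + θ) := by
        rw [ENNReal.ofReal_add hV hθ, ENNReal.ofReal_mul measureReal_nonneg, measureReal_def,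
          ENNReal.ofReal_toReal hA]

variable [MeasurableSpace X] [BorelSpace X]

/-- Mutual information is bounded from below by the integral of the free energy of finitely many
maps. -/
theorem exists_integral_freeEnergy_le {Ω : Type u} [MeasurableSpace Ω] (P : Measure Ω)
    [IsProbabilityMeasure P] {A : Set (Fin k → ℝ)} (hA : volume A ≠ ∞) (hA0 : volume A ≠ 0)
    {ξ : Ω → X} {η : Ω → L1Map A X} (hξ : Measurable ξ) (hη : Measurable η) {ε : ℝ} (hε : 0 < ε)
    (hdist : distortion P A ξ η < ENNReal.ofReal ε) {a θ : ℝ} (ha : 0 < a) (hθ : 0 < θ) :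
    ∃ (n : ℕ) (q : Fin n → ℝ) (y : Fin n → L1Map A X) (J : ℝ), (J : EReal) ≤ mutualInfo P ξ η ∧
      (∀ j, 0 ≤ q j) ∧ ∑ j, q j = 1 ∧
      ∫ x, freeEnergy a q (fun j => orbitCost A (y j)) x ∂(P.map ξ) ≤
        Real.log 2 * J + a * (volume.real A * ε + 3 * θ) := by
  classical
  have hcont : ∀ x : X, Continuous (orbitCost A (fun u => u +ᵥ x)) := fun x =>
    continuous_orbitCost hA (continuous_orbit x).aestronglyMeasurable
  obtain ⟨m, c, f, hf, hfc⟩ := exists_measurable_index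
    (fun x : X => {x' | orbitCost A (fun u => u +ᵥ x) x' < θ})
    (fun x => isOpen_lt (hcont x) continuous_const) (fun x => by simpa [orbitCost] using hθ)
  have hfc : ∀ x, orbitCost A (fun u => u +ᵥ c (f x)) x < θ := hfc
  obtain ⟨n, g, d, hg, hd0, hd⟩ := exists_measurable_quantization
    (fun (i : Fin m) (y : L1Map A X) => orbitCost A y (c i))
    (fun i => measurable_orbitCost_L1Map hA (c i)) (fun i y => orbitCost_nonneg _ _ _)
    (B := volume.real A * Metric.diam (Set.univ : Set X))
    (fun i y => by
      have : IsFiniteMeasure (volume.restrict A) := isFiniteMeasure_restrict.2 hA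
      calc _ ≤ ∫ _ in A, Metric.diam (Set.univ : Set X) :=
            integral_mono (integrableOn_dist_orbit hA y.aestronglyMeasurable _)
              (integrable_const _) fun u => dist_le_diam_univ _ _
        _ = _ := by simp) hθ
  have hne : Nonempty (L1Map A X) := by
    have : Nonempty Ω := nonempty_of_isProbabilityMeasure P
    exact this.map η
  -- Pick a representative of each cell of `g`. For an empty cell any map will do, since its weight
  -- `q j` vanishes.
  have hy : ∀ j, ∃ y : L1Map A X, (∃ y', g y' = j) → g y = j := by
    intro j
    by_cases h : ∃ y', g y' = j
    · exact ⟨h.choose, fun _ => h.choose_spec⟩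
    · exact ⟨Classical.arbitrary _, fun h' => absurd h' h⟩
  choose y hy using hy
  have hfξ : Measurable (f ∘ ξ) := hf.comp hξ
  have hgη : Measurable (g ∘ η) := hg.comp hη
  set q : Fin n → ℝ := fun j => P.real ((g ∘ η) ⁻¹' {j}) with hq
  have hq0 : ∀ j, 0 ≤ q j := fun j => measureReal_nonneg
  have hq1 : ∑ j, q j = 1 := sum_measureReal_fiber P hgη
  refine ⟨n, q, y, finMutualInfo P (f ∘ ξ) (g ∘ η), finMutualInfo_le_mutualInfo P ξ η hf hg,
    hq0, hq1, ?_⟩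
  have hgibbs := neg_sum_mul_log_sum_exp_le P hfξ hgη fun i j => a * d i j
  rw [integral_const_mul] at hgibbs
  -- The rounded cost lies below the true one, so only replacing `ξ` by the centre of its cell costs
  -- a `θ`.
  have hcost : ∫ ω, d ((f ∘ ξ) ω) ((g ∘ η) ω) ∂P ≤ volume.real A * ε + θ := by
    refine integral_le_of_distortion_lt P hA hA0 hε hdist hθ.le
      ((measurable_of_finite fun p : Fin m × Fin n => d p.1 p.2).comp (hfξ.prodMk hgη))
      (fun ω => hd0 _ _) fun ω => ?_
    refine (hd _ _).1.trans ?_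
    have h1 := orbitCost_le_add hA (η ω).aestronglyMeasurable (c (f (ξ ω))) (ξ ω)
    have h2 := hfc (ξ ω)
    rw [orbitCost_orbit_comm] at h2
    simp only [Function.comp_apply]
    linarith
  set Z : Fin m → ℝ := fun i => ∑ j, q j * Real.exp (-(a * d i j)) with hZ
  -- Two further errors of `θ`: one for moving `x` to its centre, one for the rounding. With the one
  -- in `hcost` they make up the `3 * θ`.
  have hpt : ∀ x, freeEnergy a q (fun j => orbitCost A (y j)) x ≤
      -Real.log (Z (f x)) + 2 * a * θ := by
    intro x
    have hle : Z (f x) * Real.exp (-(2 * a * θ)) ≤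
        ∑ j, q j * Real.exp (-(a * orbitCost A (y j) x)) := by
      rw [hZ, Finset.sum_mul]
      refine Finset.sum_le_sum fun j _ => ?_
      rcases (hq0 j).eq_or_lt with h | h
      · simp [← h]
      rw [mul_assoc, ← Real.exp_add]
      refine mul_le_mul_of_nonneg_left (Real.exp_le_exp.2 ?_) h.le
      have hgy : g (y j) = j := by
        refine hy j ?_
        by_contra hcon
        have : (g ∘ η) ⁻¹' {j} = ∅ := by
          ext ω
          simp only [Set.mem_preimage, Set.mem_singleton_iff, Set.mem_empty_iff_false, iff_false]
          exact fun h' => hcon ⟨_, h'⟩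
        simp [hq, this] at h
      have h1 := orbitCost_le_add hA (y j).aestronglyMeasurable x (c (f x))
      have h2 := hfc x
      have h3 := (hd (f x) (y j)).2
      rw [hgy] at h3
      have h4 : orbitCost A (y j) x ≤ d (f x) j + 2 * θ := by linarith
      have h5 := mul_le_mul_of_nonneg_left h4 ha.le
      linarith
    have hZpos : 0 < Z (f x) := sum_mul_exp_pos hq0 hq1 _
    have := Real.log_le_log (by positivity) hle
    rw [Real.log_mul hZpos.ne' (Real.exp_pos _).ne', Real.log_exp] at this
    rw [freeEnergy]
    linarith
  have : IsProbabilityMeasure (P.map ξ) := Measure.isProbabilityMeasure_map hξ.aemeasurable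
  have hint1 : Integrable (freeEnergy a q (fun j => orbitCost A (y j))) (P.map ξ) :=
    (continuous_freeEnergy hq0 hq1 fun j => continuous_orbitCost hA
      (y j).aestronglyMeasurable).integrable_of_hasCompactSupport
      (HasCompactSupport.of_compactSpace _)
  have hint2 : Integrable (fun x => -Real.log (Z (f x)) + 2 * a * θ) (P.map ξ) :=
    (Integrable.of_finite (μ := (P.map ξ).map f)
      (f := fun i => -Real.log (Z i) + 2 * a * θ)).comp_measurable hf
  have hI := integral_mono hint1 hint2 hpt
  rw [integral_comp_eq_sum (P.map ξ) hf fun i => -Real.log (Z i) + 2 * a * θ] at hI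
  have hp : ∀ i, (P.map ξ).real (f ⁻¹' {i}) = P.real ((f ∘ ξ) ⁻¹' {i}) := fun i =>
    map_measureReal_apply hξ (hf (measurableSet_singleton i))
  simp only [hp, mul_add, Finset.sum_add_distrib, mul_neg, Finset.sum_neg_distrib,
    ← Finset.sum_mul, sum_measureReal_fiber P hfξ] at hI
  have hca := mul_le_mul_of_nonneg_left hcost ha.le
  linarith

end Quantization

/-! ### Tilings of cubes -/

section Cube

variable {k : ℕ}

theorem measurableSet_cubeIco (L : ℝ) : MeasurableSet (cubeIco k L) :=
  MeasurableSet.univ_pi fun _ => measurableSet_Ico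

theorem measurableSet_cubeIcc (L : ℝ) : MeasurableSet (cubeIcc k L) :=
  MeasurableSet.univ_pi fun _ => measurableSet_Icc

theorem mem_cubeIco {L : ℝ} {u : Fin k → ℝ} : u ∈ cubeIco k L ↔ ∀ j, 0 ≤ u j ∧ u j < L := by
  simp [cubeIco, Set.mem_pi]

theorem mem_cubeIcc {L : ℝ} {u : Fin k → ℝ} : u ∈ cubeIcc k L ↔ ∀ j, 0 ≤ u j ∧ u j ≤ L := by
  simp only [cubeIcc, Set.mem_pi, Set.mem_univ, true_imp_iff, Set.mem_Icc]

theorem isCompact_cubeIcc (L : ℝ) : IsCompact (cubeIcc k L) :=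
  isCompact_univ_pi fun _ => isCompact_Icc

theorem volume_cubeIco {L : ℝ} (hL : 0 ≤ L) : volume (cubeIco k L) = ENNReal.ofReal (L ^ k) := by
  rw [cubeIco, volume_pi_pi]
  simp [Real.volume_Ico, ENNReal.ofReal_pow hL]

theorem volume_real_cubeIco {L : ℝ} (hL : 0 ≤ L) : volume.real (cubeIco k L) = L ^ k := by
  rw [measureReal_def, volume_cubeIco hL, ENNReal.toReal_ofReal (by positivity)]

theorem volume_cubeIco_ne_top {L : ℝ} (hL : 0 ≤ L) : volume (cubeIco k L) ≠ ∞ := by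
  simp [volume_cubeIco hL]

theorem integrableOn_cubeIcc {F : (Fin k → ℝ) → ℝ} (hF : Continuous F) (L : ℝ) :
    IntegrableOn F (cubeIcc k L) :=
  hF.continuousOn.integrableOn_compact (isCompact_cubeIcc L)

theorem integrableOn_cubeIco {F : (Fin k → ℝ) → ℝ} (hF : Continuous F) (L : ℝ) :
    IntegrableOn F (cubeIco k L) :=
  (integrableOn_cubeIcc hF L).mono_set (Set.pi_mono fun _ _ => Set.Ico_subset_Icc_self)

/-- The translation vectors of a tiling by cubes of side `L`. -/
def tileShift (L : ℝ) {m : ℕ} (i : Fin k → Fin m) : Fin k → ℝ := fun j => (i j : ℕ) * L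

theorem setIntegral_comp_add_right (F : (Fin k → ℝ) → ℝ) (v : Fin k → ℝ)
    (S : Set (Fin k → ℝ)) :
    ∫ u in S, F (u + v) = ∫ u in (fun u => u + -v) ⁻¹' S, F u := by
  rw [← (measurePreserving_add_right volume v).setIntegral_preimage_emb
    (measurableEmbedding_addRight v) F]
  congr 2
  rw [← Set.preimage_comp]
  ext u
  simp

/-- A cube of side `m L` is tiled by translates of the cube of side `L`. -/
theorem integral_cubeIco_natCast_mul {L : ℝ} (hL : 0 < L) (m : ℕ) {F : (Fin k → ℝ) → ℝ}
    (hF : Continuous F) :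
    ∫ u in cubeIco k (m * L), F u =
      ∑ i : Fin k → Fin m, ∫ u in cubeIco k L, F (u + tileShift L i) := by
  simp only [setIntegral_comp_add_right]
  let S : (Fin k → Fin m) → Set (Fin k → ℝ) := fun i =>
    (fun u => u + -tileShift L i) ⁻¹' cubeIco k L
  have hS : ∀ i u, u ∈ S i ↔ ∀ j, ((i j : ℕ) : ℝ) * L ≤ u j ∧ u j < ((i j : ℕ) + 1 : ℝ) * L := by
    intro i u
    simp only [S, Set.mem_preimage, mem_cubeIco, tileShift, Pi.add_apply, Pi.neg_apply]
    refine forall_congr' fun j => ?_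
    constructor <;> rintro ⟨h1, h2⟩ <;> constructor <;> linarith
  -- The tile containing `u` is read off from the integer parts of `u j / L`, hence tiles are
  -- disjoint.
  have hfloor : ∀ i u, u ∈ S i → ∀ j, ⌊u j / L⌋₊ = i j := by
    intro i u hu j
    obtain ⟨h1, h2⟩ := (hS i u).1 hu j
    rw [Nat.floor_eq_iff (div_nonneg (le_trans (by positivity) h1) hL.le), le_div_iff₀ hL,
      div_lt_iff₀ hL]
    exact ⟨h1, h2⟩
  have hsub : ∀ i, S i ⊆ cubeIco k (m * L) := by
    intro i u hu
    rw [mem_cubeIco]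
    intro j
    obtain ⟨h1, h2⟩ := (hS i u).1 hu j
    have h3 : ((i j : ℕ) + 1 : ℝ) ≤ m := by exact_mod_cast (i j).2
    exact ⟨le_trans (by positivity) h1, h2.trans_le (mul_le_mul_of_nonneg_right h3 hL.le)⟩
  have hunion : cubeIco k (m * L) = ⋃ i, S i := by
    refine Set.Subset.antisymm (fun u hu => ?_) (Set.iUnion_subset hsub)
    rw [mem_cubeIco] at hu
    have hlt : ∀ j, ⌊u j / L⌋₊ < m := fun j => by
      rw [Nat.floor_lt (div_nonneg (hu j).1 hL.le), div_lt_iff₀ hL]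
      exact (hu j).2
    refine Set.mem_iUnion.2 ⟨fun j => ⟨_, hlt j⟩, (hS _ u).2 fun j => ?_⟩
    have h1 := Nat.floor_le (div_nonneg (hu j).1 hL.le)
    have h2 := Nat.lt_floor_add_one (u j / L)
    rw [le_div_iff₀ hL] at h1
    rw [div_lt_iff₀ hL] at h2
    exact ⟨h1, h2⟩
  rw [hunion, integral_iUnion_fintype]
  · exact fun i => (measurable_id.add_const _) (measurableSet_cubeIco L)
  · intro i i' hne
    refine Set.disjoint_left.2 fun u hu hu' => hne ?_
    ext j
    exact (hfloor i u hu j).symm.trans (hfloor i' u hu' j)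
  · exact fun i => (integrableOn_cubeIco hF _).mono_set (hsub i)

/-- An integral over a large cube is, up to a boundary term, an integral over a translated tiled
subcube. -/
theorem integral_cubeIcc_le {L R : ℝ} (hL : 0 < L) {m : ℕ} (hm : (m + 1) * L ≤ R)
    {F : (Fin k → ℝ) → ℝ} (hF : Continuous F) {D : ℝ} (hD : ∀ u, F u ≤ D)
    {t : Fin k → ℝ} (ht : t ∈ cubeIco k L) :
    ∫ u in cubeIcc k R, F u ≤
      (∑ i : Fin k → Fin m, ∫ u in cubeIco k L, F (u + tileShift L i + t)) +
        D * (R ^ k - (m * L) ^ k) := by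
  have hmL : 0 ≤ (m : ℝ) * L := by positivity
  have hR : 0 < R := lt_of_lt_of_le (by positivity) hm
  have hFt : Continuous fun u => F (u + t) := hF.comp (continuous_add_const t)
  rw [← integral_cubeIco_natCast_mul (F := fun u => F (u + t)) hL m hFt,
    setIntegral_comp_add_right]
  set S : Set (Fin k → ℝ) := (fun u => u + -t) ⁻¹' cubeIco k (m * L) with hSdef
  have hSm : MeasurableSet S := (measurable_id.add_const _) (measurableSet_cubeIco _)
  -- The spare layer in `(m + 1) * L ≤ R` leaves room for the shift `t`, whose coordinates are below
  -- `L`.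
  have hSsub : S ⊆ cubeIcc k R := by
    intro u hu
    simp only [hSdef, Set.mem_preimage, mem_cubeIco, Pi.add_apply, Pi.neg_apply] at hu
    rw [mem_cubeIco] at ht
    rw [mem_cubeIcc]
    intro j
    have h1 := hu j
    have h2 := ht j
    constructor <;> nlinarith
  have hSvol : volume S = ENNReal.ofReal ((m * L) ^ k) := by
    rw [hSdef, (measurePreserving_add_right volume (-t)).measure_preimage
      (measurableSet_cubeIco _).nullMeasurableSet, volume_cubeIco hmL]
  have hint := integrableOn_cubeIcc hF R
  have hfin : volume (cubeIcc k R \ S) ≠ ∞ :=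
    ((measure_mono Set.sdiff_subset).trans_lt (isCompact_cubeIcc R).measure_lt_top).ne
  have hdvol : volume.real (cubeIcc k R \ S) = R ^ k - (m * L) ^ k := by
    rw [measureReal_sdiff hSsub hSm (isCompact_cubeIcc R).measure_lt_top.ne, measureReal_def, measureReal_def, hSvol, volume_cubeIcc hR,
      ENNReal.toReal_ofReal (by positivity), ENNReal.toReal_ofReal (by positivity)]
  have hsplit : ∫ u in cubeIcc k R, F u = (∫ u in S, F u) + ∫ u in cubeIcc k R \ S, F u := by
    rw [← setIntegral_union Set.disjoint_sdiff_right ((measurableSet_cubeIcc R).diff hSm)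
      (hint.mono_set hSsub) (hint.mono_set Set.sdiff_subset), Set.union_sdiff_cancel hSsub]
  have hrest : ∫ u in cubeIcc k R \ S, F u ≤ D * (R ^ k - (m * L) ^ k) := by
    have : IsFiniteMeasure (volume.restrict (cubeIcc k R \ S)) := isFiniteMeasure_restrict.2 hfin
    calc ∫ u in cubeIcc k R \ S, F u ≤ ∫ _ in cubeIcc k R \ S, D :=
          integral_mono (hint.mono_set Set.sdiff_subset) (integrable_const D) hD
      _ = _ := by simp [hdvol, mul_comm]
  rw [hsplit]
  linarith

end Cube

/-! ### Energy estimates -/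

section Energy

/-- Exponential integrals of a cost function under a measure with a power law on small sets. -/
theorem integral_exp_neg_le {k : ℕ} {X : Type u} [MetricSpace X] [CompactSpace X]
    [AddAction (Fin k → ℝ) X] [MeasurableSpace X] [BorelSpace X] {R : ℝ} (hR : 0 < R) (ν : Measure X) [IsProbabilityMeasure ν]
    {s δ C r a κ : ℝ} (hs : 0 < s) (hC : 0 < C) (hr : 0 < r) (hrδ : 3 * r < δ) (ha : 0 ≤ a)
    (hpow : ∀ A : Set X, MeasurableSet A → avgDiam k R A < ENNReal.ofReal δ →
      ν A ≤ (ENNReal.ofReal C * avgDiam k R A) ^ (s * R ^ k))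
    {Ψ : X → ℝ} (hΨ : Continuous Ψ) (hΨ0 : ∀ x, 0 ≤ Ψ x) (hκ : κ ≤ R ^ k * r)
    (hle : ∀ x x', R ^ k * avgDist k R x x' ≤ Ψ x + Ψ x' + κ) :
    ∫ x, Real.exp (-(a * Ψ x)) ∂ν ≤
      Real.exp (Real.log (3 * C * r) * (s * R ^ k)) + Real.exp (-(a * (R ^ k * r))) := by
  have hN : 0 < R ^ k := by positivity
  set B : Set X := {x | Ψ x ≤ R ^ k * r} with hB
  have hBm : MeasurableSet B := (isClosed_le hΨ continuous_const).measurableSet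
  -- One `r` for each of the two points, and one for the boundary error `κ`.
  have hdiam : avgDiam k R B ≤ ENNReal.ofReal (3 * r) := by
    refine iSup₂_le fun x hx => iSup₂_le fun x' hx' => ENNReal.ofReal_le_ofReal ?_
    have h1 := hle x x'
    have h2 : Ψ x ≤ R ^ k * r := hx
    have h3 : Ψ x' ≤ R ^ k * r := hx'
    refine le_of_mul_le_mul_left ?_ hN
    linarith
  have hνB : ν.real B ≤ Real.exp (Real.log (3 * C * r) * (s * R ^ k)) := by
    have hlt : avgDiam k R B < ENNReal.ofReal δ :=
      hdiam.trans_lt ((ENNReal.ofReal_lt_ofReal_iff (by linarith)).2 hrδ)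
    have h1 : ν B ≤ ENNReal.ofReal ((3 * C * r) ^ (s * R ^ k)) := by
      refine (hpow B hBm hlt).trans ?_
      rw [← ENNReal.ofReal_rpow_of_nonneg (by positivity) (by positivity)]
      refine ENNReal.rpow_le_rpow ?_ (by positivity)
      have h3 : 3 * C * r = C * (3 * r) := by ring
      rw [h3, ENNReal.ofReal_mul hC.le]
      gcongr
    rw [← Real.rpow_def_of_pos (by positivity)]
    exact ENNReal.toReal_le_of_le_ofReal (by positivity) h1
  have hpt : ∀ x, Real.exp (-(a * Ψ x)) ≤
      B.indicator (fun _ => (1 : ℝ)) x + Real.exp (-(a * (R ^ k * r))) := by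
    intro x
    by_cases hx : x ∈ B
    · have h1 : Real.exp (-(a * Ψ x)) ≤ 1 := by
        rw [Real.exp_le_one_iff]
        have := mul_nonneg ha (hΨ0 x)
        linarith
      rw [Set.indicator_of_mem hx]
      linarith [Real.exp_pos (-(a * (R ^ k * r)))]
    · have : R ^ k * r ≤ Ψ x := (not_le.1 hx).le
      rw [Set.indicator_of_notMem hx, zero_add]
      exact Real.exp_le_exp.2 (neg_le_neg (mul_le_mul_of_nonneg_left this ha))
  have hiB : Integrable (B.indicator fun _ => (1 : ℝ)) ν := (integrable_const 1).indicator hBm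
  have hexp : Continuous fun x => Real.exp (-(a * Ψ x)) := by fun_prop
  have hmono := integral_mono (hexp.integrable_of_hasCompactSupport (μ := ν)
    (HasCompactSupport.of_compactSpace _)) (hiB.add (integrable_const _)) hpt
  refine hmono.trans ?_
  simp only [Pi.add_apply]
  rw [integral_add hiB (integrable_const _), integral_indicator_const _ hBm]
  simpa using hνB

variable {k : ℕ} {X : Type u} [MetricSpace X] [CompactSpace X]
  [AddAction (Fin k → ℝ) X] [ContinuousVAdd (Fin k → ℝ) X]

/-- The averaged distance is bounded by the costs of describing both orbits by the same tuple of
maps on the tiles of a translated tiling. -/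
theorem pow_mul_avgDist_le {L R : ℝ} (hL : 0 < L) {m : ℕ} (hm : (m + 1) * L ≤ R)
    {y : (Fin k → Fin m) → (Fin k → ℝ) → X}
    (hy : ∀ i, AEStronglyMeasurable (y i) (volume.restrict (cubeIco k L)))
    {t : Fin k → ℝ} (ht : t ∈ cubeIco k L) (x x' : X) :
    R ^ k * avgDist k R x x' ≤
      ∑ i, orbitCost (cubeIco k L) (y i) ((tileShift L i + t) +ᵥ x) +
      ∑ i, orbitCost (cubeIco k L) (y i) ((tileShift L i + t) +ᵥ x') +
        Metric.diam (Set.univ : Set X) * (R ^ k - (m * L) ^ k) := by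
  have hR : 0 < R := lt_of_lt_of_le (by positivity) hm
  rw [avgDist, mul_inv_cancel_left₀ (by positivity)]
  refine (integral_cubeIcc_le hL hm ((continuous_orbit x).dist (continuous_orbit x'))
    (fun u => dist_le_diam_univ _ _) ht).trans ?_
  rw [← Finset.sum_add_distrib]
  gcongr with i _
  have := orbitCost_orbit_le_add (volume_cubeIco_ne_top hL.le) (hy i)
    ((tileShift L i + t) +ᵥ x) ((tileShift L i + t) +ᵥ x')
  refine le_trans (le_of_eq ?_) this
  simp only [orbitCost, vadd_vadd, add_assoc]

variable [MeasurableSpace X] [BorelSpace X]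

theorem integral_orbitAverageMeasure {R : ℝ} (hR : 0 < R) (ν : Measure X) [IsProbabilityMeasure ν]
    {φ : X → ℝ} (hφ : Continuous φ) :
    ∫ x, φ x ∂(orbitAverageMeasure k R ν) =
      (R ^ k)⁻¹ * ∫ u in cubeIcc k R, ∫ x, φ (u +ᵥ x) ∂ν := by
  have hm : Measurable fun p : (Fin k → ℝ) × X => p.1 +ᵥ p.2 := continuous_vadd.measurable
  have : IsFiniteMeasure ((volume : Measure (Fin k → ℝ)).restrict (cubeIcc k R)) :=
    isFiniteMeasure_restrict.2 (isCompact_cubeIcc R).measure_lt_top.ne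
  obtain ⟨M, hM⟩ := isCompact_univ.exists_bound_of_continuousOn hφ.continuousOn
  rw [orbitAverageMeasure, integral_smul_measure, ENNReal.toReal_ofReal (by positivity),
    integral_map hm.aemeasurable hφ.aestronglyMeasurable, smul_eq_mul, integral_prod]
  exact Integrable.of_bound (hφ.comp continuous_vadd).aestronglyMeasurable M
    (Eventually.of_forall fun p => hM _ (Set.mem_univ _))

/-- Dominated convergence; it makes the tiling identities, stated for continuous integrands,
applicable to the averaged free energy. -/
theorem continuous_integral_vadd (ν : Measure X) [IsProbabilityMeasure ν]
    {φ : X → ℝ} (hφ : Continuous φ) :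
    Continuous fun u : Fin k → ℝ => ∫ x, φ (u +ᵥ x) ∂ν := by
  obtain ⟨M, hM⟩ := isCompact_univ.exists_bound_of_continuousOn hφ.continuousOn
  exact continuous_of_dominated (bound := fun _ => M)
    (fun u => (hφ.comp (continuous_const_vadd u)).aestronglyMeasurable)
    (fun u => Eventually.of_forall fun x => hM _ (Set.mem_univ _)) (integrable_const _)
    (Eventually.of_forall fun x => hφ.comp (continuous_orbit x))

/-- The integral of a free energy over an orbit average of a measure with a power law on small
sets. -/
theorem le_integral_freeEnergy_orbitAverageMeasure {L R : ℝ} (hL : 0 < L) {m : ℕ}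
    (hm : (m + 1) * L ≤ R) (hR1 : 1 ≤ R ^ k) (ν : Measure X) [IsProbabilityMeasure ν]
    {s δ C r a β : ℝ} (hs : 0 < s) (hC : 0 < C) (hr : 0 < r) (hrδ : 3 * r < δ) (ha : 0 ≤ a)
    (hpow : ∀ A : Set X, MeasurableSet A → avgDiam k R A < ENNReal.ofReal δ →
      ν A ≤ (ENNReal.ofReal C * avgDiam k R A) ^ (s * R ^ k))
    (hκ : Metric.diam (Set.univ : Set X) * (R ^ k - (m * L) ^ k) ≤ R ^ k * r)
    (hβ : β ≤ a * r) (hβ' : Real.log (3 * C * r) * s ≤ -β)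
    {ι : Type*} [Fintype ι] {q : ι → ℝ} (hq : ∀ j, 0 ≤ q j) (hq1 : ∑ j, q j = 1)
    {y : ι → (Fin k → ℝ) → X}
    (hy : ∀ j, AEStronglyMeasurable (y j) (volume.restrict (cubeIco k L))) :
    L ^ k * (β - 1) ≤ ∫ x, freeEnergy a q (fun j => orbitCost (cubeIco k L) (y j)) x
      ∂(orbitAverageMeasure k R ν) := by
  classical
  have hR : 0 < R := lt_of_lt_of_le (by positivity) hm
  have hN : 0 < R ^ k := by positivity
  set ρ : ι → X → ℝ := fun j => orbitCost (cubeIco k L) (y j) with hρdef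
  have hρ : ∀ j, Continuous (ρ j) := fun j =>
    continuous_orbitCost (volume_cubeIco_ne_top hL.le) (hy j)
  have hφ : Continuous (freeEnergy a q ρ) := continuous_freeEnergy hq hq1 hρ
  have hφ0 : ∀ x, 0 ≤ freeEnergy a q ρ x :=
    freeEnergy_nonneg ha hq hq1 fun j x => orbitCost_nonneg _ _ _
  set h : (Fin k → ℝ) → ℝ := fun u => ∫ x, freeEnergy a q ρ (u +ᵥ x) ∂ν with hh
  have hhc : Continuous h := continuous_integral_vadd ν hφ
  have hh0 : ∀ u, 0 ≤ h u := fun u => integral_nonneg fun x => hφ0 _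
  have htile : ∀ t ∈ cubeIco k L, R ^ k * β - 1 ≤ ∑ i : Fin k → Fin m, h (t + tileShift L i) := by
    intro t ht
    -- The two exponential terms are each at most `exp(-(R ^ k * β))`; the extra `1` in the exponent
    -- absorbs their number, as `2 ≤ exp 1`.
    have hJ := neg_log_le_integral_sum_freeEnergy (a := a) ν hq hq1 hρ
      (fun (i : Fin k → Fin m) (x : X) => (tileShift L i + t) +ᵥ x)
      (fun i => continuous_const_vadd _) (Real.exp_pos (1 - R ^ k * β)) (fun c => by
        refine (integral_exp_neg_le hR ν hs hC hr hrδ ha hpow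
          (Ψ := fun x => ∑ i, ρ (c i) ((tileShift L i + t) +ᵥ x))
          (continuous_finsetSum _ fun i _ => (hρ _).comp (continuous_const_vadd _))
          (fun x => Finset.sum_nonneg fun i _ => orbitCost_nonneg _ _ _) hκ
          (pow_mul_avgDist_le hL hm (fun i => hy (c i)) ht)).trans ?_
        have h1 : Real.exp (Real.log (3 * C * r) * (s * R ^ k)) ≤ Real.exp (-(R ^ k * β)) := by
          refine Real.exp_le_exp.2 ?_
          have := mul_le_mul_of_nonneg_right hβ' hN.le
          linarith
        have h2 : Real.exp (-(a * (R ^ k * r))) ≤ Real.exp (-(R ^ k * β)) := by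
          refine Real.exp_le_exp.2 ?_
          have := mul_le_mul_of_nonneg_left hβ hN.le
          linarith
        have h3 : Real.exp (1 - R ^ k * β) = Real.exp 1 * Real.exp (-(R ^ k * β)) := by
          rw [← Real.exp_add]; ring_nf
        have h4 : (2 : ℝ) ≤ Real.exp 1 := by
          have := Real.add_one_le_exp (1 : ℝ)
          linarith
        have h5 := mul_le_mul_of_nonneg_right h4 (Real.exp_pos (-(R ^ k * β))).le
        rw [h3]
        linarith)
    rw [Real.log_exp, integral_finsetSum] at hJ
    · have heq : ∀ i : Fin k → Fin m, ∫ x, freeEnergy a q ρ ((tileShift L i + t) +ᵥ x) ∂ν =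
          h (t + tileShift L i) := fun i => by rw [hh, add_comm]
      simp only [heq] at hJ
      linarith
    · exact fun i _ => (hφ.comp (continuous_const_vadd _)).integrable_of_hasCompactSupport
        (HasCompactSupport.of_compactSpace _)
  -- Integrating over all shifts `t` in one tile turns the sum over tiles into an integral over the
  -- cube of side `m * L`. Enlarging the cube is harmless since `h` is nonnegative.
  have hcube : L ^ k * (R ^ k * β - 1) ≤ ∫ u in cubeIcc k R, h u := by
    have hsub : cubeIco k (m * L) ⊆ cubeIcc k R := by
      intro u hu
      rw [mem_cubeIco] at hu
      rw [mem_cubeIcc]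
      exact fun j => ⟨(hu j).1, (hu j).2.le.trans (by linarith)⟩
    have : IsFiniteMeasure ((volume : Measure (Fin k → ℝ)).restrict (cubeIco k L)) :=
      isFiniteMeasure_restrict.2 (volume_cubeIco_ne_top hL.le)
    have hshift : ∀ i : Fin k → Fin m, Continuous fun u => h (u + tileShift L i) := fun i =>
      hhc.comp (continuous_add_const _)
    calc L ^ k * (R ^ k * β - 1) = ∫ _ in cubeIco k L, (R ^ k * β - 1) := by
          simp [volume_real_cubeIco hL.le]
      _ ≤ ∫ u in cubeIco k L, ∑ i : Fin k → Fin m, h (u + tileShift L i) :=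
          setIntegral_mono_on (integrable_const _)
            (integrableOn_cubeIco (continuous_finsetSum _ fun i _ => hshift i) L)
            (measurableSet_cubeIco L) htile
      _ = ∫ u in cubeIco k (m * L), h u := by
          rw [integral_finsetSum _ fun i _ => integrableOn_cubeIco (hshift i) L,
            integral_cubeIco_natCast_mul hL m hhc]
      _ ≤ ∫ u in cubeIcc k R, h u :=
          setIntegral_mono_set (integrableOn_cubeIcc hhc R)
            (Eventually.of_forall hh0) (LE.le.eventuallyLE hsub)
  rw [integral_orbitAverageMeasure hR ν hφ, ← div_eq_inv_mul, le_div_iff₀ hN]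
  refine le_trans ?_ hcube
  have hLk : 0 < L ^ k := by positivity
  nlinarith [mul_le_mul_of_nonneg_left hR1 hLk.le]

end Energy

/-! ### The lower bound of the rate distortion function -/

/-- Large cubes are tiled up to a small proportion of their volume. -/
theorem eventually_exists_tiling (k : ℕ) {R : ℕ → ℝ} (hR : Tendsto R atTop atTop) {L : ℝ}
    (hL : 0 < L) (D : ℝ) {r : ℝ} (hr : 0 < r) :
    ∀ᶠ n in atTop, ∃ m : ℕ, (m + 1) * L ≤ R n ∧ 1 ≤ R n ^ k ∧
      D * (R n ^ k - (m * L) ^ k) ≤ R n ^ k * r := by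
  have hlim : Tendsto (fun n => |D| * (1 - (1 - 2 * L / R n) ^ k)) atTop (𝓝 0) := by
    have h1 : Tendsto (fun n => 2 * L / R n) atTop (𝓝 0) := hR.const_div_atTop _
    have h2 := (((h1.const_sub 1).pow k).const_sub 1).const_mul |D|
    simpa using h2
  filter_upwards [hlim.eventually_le_const hr, hR.eventually_ge_atTop 1,
    hR.eventually_ge_atTop (2 * L)] with n h1 h2 h3
  have hRpos : 0 < R n := by linarith
  have hfl1 := Nat.floor_le (div_nonneg hRpos.le hL.le)
  have hfl2 := Nat.lt_floor_add_one (R n / L)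
  have hfl3 : 1 ≤ ⌊R n / L⌋₊ := by
    rw [Nat.one_le_floor_iff, le_div_iff₀ hL]
    linarith
  -- Take `m = ⌊R n / L⌋₊ - 1`: one layer of tiles is kept free for the shift, and still `m * L ≥ R
  -- n - 2 * L`.
  obtain ⟨m, hm⟩ := Nat.exists_eq_add_of_le' hfl3
  rw [hm] at hfl1 hfl2
  push_cast at hfl1 hfl2
  rw [le_div_iff₀ hL] at hfl1
  rw [div_lt_iff₀ hL] at hfl2
  have hmL : 0 ≤ (m : ℝ) * L := by positivity
  refine ⟨m, hfl1, one_le_pow₀ h2, ?_⟩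
  have hle : (R n * (1 - 2 * L / R n)) ^ k ≤ (m * L) ^ k := by
    have h4 : R n * (1 - 2 * L / R n) = R n - 2 * L := by field_simp
    rw [h4]
    exact pow_le_pow_left₀ (by linarith) (by linarith) k
  have hle' : (m * L) ^ k ≤ R n ^ k := pow_le_pow_left₀ hmL (by linarith) k
  have hN : 0 < R n ^ k := by positivity
  calc D * (R n ^ k - (m * L) ^ k) ≤ |D| * (R n ^ k - (m * L) ^ k) :=
        mul_le_mul_of_nonneg_right (le_abs_self D) (by linarith)
    _ ≤ |D| * (R n ^ k - (R n * (1 - 2 * L / R n)) ^ k) :=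
        mul_le_mul_of_nonneg_left (by linarith) (abs_nonneg D)
    _ = R n ^ k * (|D| * (1 - (1 - 2 * L / R n) ^ k)) := by rw [mul_pow]; ring
    _ ≤ R n ^ k * r := mul_le_mul_of_nonneg_left h1 hN.le

section Rate

theorem le_rateDistortion {k : ℕ} {X : Type u} [MetricSpace X] [MeasurableSpace X]
    [AddAction (Fin k → ℝ) X] {μ : Measure X} {ε b : ℝ}
    (h : ∀ L : ℝ, 0 < L → ((L ^ k * b : ℝ) : EReal) ≤ rateOn μ ε (cubeIco k L)) :
    (b : EReal) ≤ rateDistortion k μ ε := by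
  refine le_liminf_of_le (by isBoundedDefault) ?_
  filter_upwards [eventually_gt_atTop 0] with L hL
  have hLk : 0 < L ^ k := by positivity
  rw [EReal.le_div_iff_mul_le (by exact_mod_cast hLk) (EReal.coe_ne_top _), ← EReal.coe_mul,
    mul_comm]
  exact h L hL

variable {k : ℕ} {X : Type u} [MetricSpace X] [CompactSpace X] [MeasurableSpace X] [BorelSpace X]
  [AddAction (Fin k → ℝ) X] [ContinuousVAdd (Fin k → ℝ) X]

/-- Lower bound of the rate distortion function of a limit of orbit averages. -/
theorem le_rateOn {s : ℝ} (hs : 0 < s)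
    {R : ℕ → ℝ} (hR : ∀ n, 0 < R n) (hR_top : Tendsto R atTop atTop)
    {ν : ℕ → ProbabilityMeasure X} {δ C : ℝ} (hC : 0 < C)
    (hpow : ∀ (n : ℕ) (A : Set X), MeasurableSet A → avgDiam k (R n) A < ENNReal.ofReal δ →
      (ν n : Measure X) A ≤ (ENNReal.ofReal C * avgDiam k (R n) A) ^ (s * R n ^ k))
    {μ : ProbabilityMeasure X} (hlim : Tendsto (fun n => orbitAverage k (hR n) (ν n)) atTop (𝓝 μ))
    {ε r β : ℝ} (hε : 0 < ε) (hr : 0 < r) (hrδ : 3 * r < δ)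
    (hβ : β ≤ ε⁻¹ * r) (hβ' : Real.log (3 * C * r) * s ≤ -β) {L : ℝ} (hL : 0 < L) :
    ((L ^ k * ((β - 5) / Real.log 2) : ℝ) : EReal) ≤
      rateOn (μ : Measure X) ε (cubeIco k L) := by
  refine le_sInf ?_
  rintro _ ⟨Ω, _, P, ξ, η, hP, hξ, hη, hmap, hdist, rfl⟩
  have hLk : 0 < L ^ k := by positivity
  have hA := volume_cubeIco_ne_top (k := k) hL.le
  have hA0 : volume (cubeIco k L) ≠ 0 := by simp [volume_cubeIco hL.le, hLk]
  have hεinv : 0 < ε⁻¹ := by positivity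
  obtain ⟨n, q, y, J, hJ, hq, hq1, hle⟩ :=
    -- With `a = ε⁻¹` and `θ = ε * L ^ k`, distortion and quantization together cost `4 * L ^ k`.
    -- Adding the `1` from the energy estimate gives the `5` in the bound.
    exists_integral_freeEnergy_le P hA hA0 hξ hη hε hdist hεinv (θ := ε * L ^ k) (by positivity)
  refine le_trans (EReal.coe_le_coe_iff.2 ?_) hJ
  have hφ : Continuous (freeEnergy ε⁻¹ q fun j => orbitCost (cubeIco k L) (y j)) :=
    continuous_freeEnergy hq hq1 fun j => continuous_orbitCost hA (y j).aestronglyMeasurable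
  have hconv := ProbabilityMeasure.tendsto_iff_forall_integral_tendsto.1 hlim
    (BoundedContinuousFunction.mkOfCompact ⟨_, hφ⟩)
  have hge : L ^ k * (β - 1) ≤
      ∫ x, freeEnergy ε⁻¹ q (fun j => orbitCost (cubeIco k L) (y j)) x ∂(μ : Measure X) := by
    refine ge_of_tendsto hconv ?_
    filter_upwards [eventually_exists_tiling k hR_top hL (Metric.diam (Set.univ : Set X)) hr]
      with i ⟨m, hm, h1, hκ⟩
    exact le_integral_freeEnergy_orbitAverageMeasure hL hm h1 (ν i : Measure X) hs hC hr hrδ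
      hεinv.le (hpow i) hκ hβ hβ' hq hq1 fun j => (y j).aestronglyMeasurable
  rw [hmap, volume_real_cubeIco hL.le] at hle
  have h4 : ε⁻¹ * (L ^ k * ε + 3 * (ε * L ^ k)) = 4 * L ^ k := by field_simp; ring
  rw [h4] at hle
  rw [← mul_div_assoc, div_le_iff₀ (Real.log_pos one_lt_two)]
  linarith

end Rate

/-! ### Choice of the scale and conclusion -/

theorem tendsto_log_inv_nhdsGT_zero :
    Tendsto (fun ε : ℝ => Real.log (1 / ε)) (𝓝[>] 0) atTop := by
  simp only [one_div]
  exact Real.tendsto_log_atTop.comp tendsto_inv_nhdsGT_zero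

end RateDist

theorem mainTheorem7 {k : ℕ} {X : Type u} [MetricSpace X] [CompactSpace X]
    [MeasurableSpace X] [BorelSpace X]
    [AddAction (Fin k → ℝ) X] [ContinuousVAdd (Fin k → ℝ) X]
    (s : ℝ) (hs : 0 < s)
    (L : ℕ → ℝ) (hL : ∀ n, 0 < L n) (hL_top : Tendsto L atTop atTop)
    (ν : ℕ → ProbabilityMeasure X)
    (δ C : ℝ) (hδ : 0 < δ) (hC : 0 < C)
    (hpow : ∀ (n : ℕ) (A : Set X), MeasurableSet A →
      RateDist.avgDiam k (L n) A < ENNReal.ofReal δ →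
      (ν n : Measure X) A ≤
        (ENNReal.ofReal C * RateDist.avgDiam k (L n) A) ^ (s * L n ^ k))
    (μ : ProbabilityMeasure X) (hinv : VAddInvariantMeasure (Fin k → ℝ) X (μ : Measure X))
    (hlim : Tendsto (fun n => RateDist.orbitAverage k (hL n) (ν n)) atTop (𝓝 μ)) :
    (s : EReal) ≤ RateDist.lowerRateDistortionDim k (μ : Measure X) := by
  -- The positive part lets `c` serve twice: it dominates `log (3Cs)` in the power-law exponent, and
  -- `c ≥ 0` gives `β ≤ ε⁻¹ * r`.
  set c : ℝ := max (Real.log (3 * C * s)) 0 with hc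
  set ℓ : ℝ → ℝ := fun ε => Real.log (1 / ε) with hℓ
  have hℓ_top : Tendsto ℓ (𝓝[>] 0) atTop := RateDist.tendsto_log_inv_nhdsGT_zero
  have hlim1 : Tendsto (fun ε => s * (1 - c / ℓ ε - Real.log (ℓ ε) / ℓ ε) - 5 / ℓ ε)
      (𝓝[>] 0) (𝓝 s) := by
    have h1 : Tendsto (fun ε => Real.log (ℓ ε) / ℓ ε) (𝓝[>] 0) (𝓝 0) :=
      Real.isLittleO_log_id_atTop.tendsto_div_nhds_zero.comp hℓ_top
    have h2 := ((((hℓ_top.const_div_atTop c).const_sub 1).sub h1).const_mul s).sub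
      (hℓ_top.const_div_atTop 5)
    simpa using h2
  -- Ensures `3 * r < δ` for small `ε`, where `r = s * ε * ℓ ε`.
  have hlim2 : Tendsto (fun ε : ℝ => 3 * (s * ε * ℓ ε)) (𝓝[>] 0) (𝓝 0) := by
    have h1 := (tendsto_log_mul_rpow_nhdsGT_zero one_pos).const_mul (-(3 * s))
    rw [mul_zero] at h1
    refine h1.congr fun ε => ?_
    simp only [hℓ, one_div, Real.log_inv, Real.rpow_one]
    ring
  have hlim3 := (continuous_coe_real_ereal.tendsto s).comp hlim1
  rw [← hlim3.liminf_eq]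
  refine liminf_le_liminf ?_
  filter_upwards [self_mem_nhdsWithin, hℓ_top.eventually_ge_atTop 1,
    hlim2.eventually_lt_const hδ] with ε hε hℓ1 hsmall
  have hε : 0 < ε := hε
  have hℓ0 : 0 < ℓ ε := by linarith
  have hlogℓ : 0 ≤ Real.log (ℓ ε) := Real.log_nonneg hℓ1
  have hr : 0 < s * ε * ℓ ε := by positivity
  -- Here `ε⁻¹ * r = s * ℓ ε`, while `-s * log (3Cr) = s * (ℓ ε - log (3Cs) - log (ℓ ε))`; this `β`
  -- lies below both.
  have hrate := RateDist.le_rateDistortion fun L' hL' =>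
    RateDist.le_rateOn (β := s * (ℓ ε - c - Real.log (ℓ ε))) hs hL hL_top hC hpow hlim hε hr hsmall
      (by
        have : ε⁻¹ * (s * ε * ℓ ε) = s * ℓ ε := by field_simp
        rw [this]
        have := le_max_right (Real.log (3 * C * s)) 0
        exact mul_le_mul_of_nonneg_left (by linarith) hs.le)
      (by
        have h1 : 3 * C * (s * ε * ℓ ε) = (3 * C * s) * (ε * ℓ ε) := by ring
        have h2 : Real.log ε = -ℓ ε := by simp [hℓ]
        rw [h1, Real.log_mul (by positivity) (by positivity), Real.log_mul hε.ne' hℓ0.ne', h2]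
        have := le_max_left (Real.log (3 * C * s)) 0
        have h3 : Real.log (3 * C * s) + (-ℓ ε + Real.log (ℓ ε)) ≤
            -(ℓ ε - c - Real.log (ℓ ε)) := by linarith
        have := mul_le_mul_of_nonneg_right h3 hs.le
        linarith) hL'
  have hlog2 := Real.log_pos one_lt_two
  have hpos : 0 < Real.logb 2 (1 / ε) := div_pos hℓ0 hlog2
  rw [EReal.le_div_iff_mul_le (by exact_mod_cast hpos) (EReal.coe_ne_top _)]
  refine le_trans (le_of_eq ?_) hrate
  rw [Function.comp_apply, ← EReal.coe_mul, EReal.coe_eq_coe_iff]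
  have : Real.logb 2 (1 / ε) = ℓ ε / Real.log 2 := rfl
  rw [this]
  field_simp
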